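/- Let $\mathcal H_a,\mathcal H_b$ be finite-dimensional complex Hilbert spaces, and let $\Pi^1,\Pi^2$ be mutually orthogonal projectors on $\mathcal H_a$ with $\Pi^1+\Pi^2=\mathbb 1$. For $x\in\mathbb R$ put $$\tau_1=\sqrt{\tfrac{1-\tanh x}{2}},\quad \tau_2=\sqrt{\tfrac{1+\tanh x}{2}},\quad \Omega_x=\tau_1\Pi^1+\tau_2\Pi^2,\quad \Omega_{-x}=\tau_2\Pi^1+\tau_1\Pi^2 ,$$ and for operators $X$ on $\mathcal H_a\otimes\mathcal H_b$ let $$\Omega(X)=\sum_{k=\pm x}(\Omega_k\otimes\mathbb 1)X(\Omega_k\otimes\mathbb 1),\qquad \Pi^a(X)=\sum_{k=1,2}(\Pi^k\otimes\mathbb 1)X(\Pi^k\otimes\mathbb 1).$$ For a state (density operator) $\rho$ on $\mathcal H_a\otimes\mathcal H_b$ define the coherence relative to the weak measurement by $$C_H(\rho|\Omega)=\big\|\sqrt\rho-\Omega(\sqrt\rho)\big\|^2,\qquad \|O\|=\sqrt{\operatorname{tr}(O^\dagger O)},$$ and let $\mathcal I_p=\{\sigma \text{ a state}:\Pi^a(\sigma)=\sigma\}$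 be the set of partially incoherent states. Strong monotonicity: let $\{A_k\}$ be a finite family of operators on $\mathcal H_a\otimes\mathcal H_b$ with $\sum_kA_k^\dagger A_k=\mathbb 1$ that are partially incoherent, i.e. for every $k$ and every $\sigma\in\mathcal I_p$ with $\operatorname{tr}(A_k\sigma A_k^\dagger)\neq 0$ one has $A_k\sigma A_k^\dagger/\operatorname{tr}(A_k\sigma A_k^\dagger)\in\mathcal I_p$. Then for every state $\rho$ on $\mathcal H_a\otimes\mathcal H_b$, $$C_H(\rho|\Omega)\;\ge\;\sum_k p_k\,C_H(\rho_k|\Omega),\qquad p_k=\operatorname{tr}(A_k\rho A_k^\dagger),\quad \rho_k=A_k\rho A_k^\dagger/p_k,$$ where terms with $p_k=0$ are counted as $0$. -/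

import Mathlib

open scoped Kronecker Matrix MatrixOrder ComplexOrder

noncomputable section

namespace WeakCoherence

/-- Density matrices on the Hilbert space with orthonormal basis indexed by `n`. -/
def IsState {n : Type*} [Fintype n] (ρ : Matrix n n ℂ) : Prop :=
  ρ.PosSemidef ∧ ρ.trace = 1

/-- The Hilbert-Schmidt norm `‖O‖ = √(tr (O† O))`. -/
def hsNorm {n : Type*} [Fintype n] (O : Matrix n n ℂ) : ℝ :=
  Real.sqrt (Oᴴ * O).trace.re

/-- A pair `P 0, P 1` of mutually orthogonal (self-adjoint) projectors on the subsystem `a`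
with `P 0 + P 1 = 1`. -/
structure IsTwoOutcomeProjective {a : Type*} [Fintype a] [DecidableEq a]
    (P : Fin 2 → Matrix a a ℂ) : Prop where
  isHermitian : ∀ i, (P i).IsHermitian
  idempotent : ∀ i, P i * P i = P i
  orthogonal : ∀ i j, i ≠ j → P i * P j = 0
  sum_eq_one : P 0 + P 1 = 1

/-- The local projective measurement `Π^a(X) = ∑ₖ (Πₖ ⊗ 1) X (Πₖ ⊗ 1)`. -/
def localMeasurement {a b : Type*} [Fintype a] [Fintype b] [DecidableEq b]
    (P : Fin 2 → Matrix a a ℂ) (X : Matrix (a × b) (a × b) ℂ) :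
    Matrix (a × b) (a × b) ℂ :=
  ∑ k, (P k ⊗ₖ (1 : Matrix b b ℂ)) * X * (P k ⊗ₖ (1 : Matrix b b ℂ))

/-- The coefficient `τ₁ = √((1 - tanh x) / 2)`. -/
def tau1 (x : ℝ) : ℝ := Real.sqrt ((1 - Real.tanh x) / 2)

/-- The coefficient `τ₂ = √((1 + tanh x) / 2)`. -/
def tau2 (x : ℝ) : ℝ := Real.sqrt ((1 + Real.tanh x) / 2)

/-- The weak measurement operator `Ωₓ = τ₁ Π¹ + τ₂ Π²`. -/
def weakOpPos {a : Type*} (P : Fin 2 → Matrix a a ℂ) (x : ℝ) : Matrix a a ℂ :=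
  (tau1 x : ℂ) • P 0 + (tau2 x : ℂ) • P 1

/-- The weak measurement operator `Ω₋ₓ = τ₂ Π¹ + τ₁ Π²`. -/
def weakOpNeg {a : Type*} (P : Fin 2 → Matrix a a ℂ) (x : ℝ) : Matrix a a ℂ :=
  (tau2 x : ℂ) • P 0 + (tau1 x : ℂ) • P 1

/-- The weak measurement map `Ω(X) = ∑_{k = ±x} (Ωₖ ⊗ 1) X (Ωₖ ⊗ 1)`. -/
def weakMeasurement {a b : Type*} [Fintype a] [Fintype b] [DecidableEq b]
    (P : Fin 2 → Matrix a a ℂ) (x : ℝ) (X : Matrix (a × b) (a × b) ℂ) :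
    Matrix (a × b) (a × b) ℂ :=
  (weakOpPos P x ⊗ₖ (1 : Matrix b b ℂ)) * X * (weakOpPos P x ⊗ₖ (1 : Matrix b b ℂ)) +
    (weakOpNeg P x ⊗ₖ (1 : Matrix b b ℂ)) * X * (weakOpNeg P x ⊗ₖ (1 : Matrix b b ℂ))

/-- The coherence relative to the weak measurement,
`C_H(ρ|Ω) = ‖√ρ - Ω(√ρ)‖²`. -/
def weakCoherence {a b : Type*} [Fintype a] [DecidableEq a] [Fintype b] [DecidableEq b]
    (P : Fin 2 → Matrix a a ℂ) (x : ℝ) (ρ : Matrix (a × b) (a × b) ℂ) : ℝ :=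
  hsNorm (CFC.sqrt ρ - weakMeasurement P x (CFC.sqrt ρ)) ^ 2

/-- The set `I_p` of partially incoherent states: states `ρ` with `Π^a(ρ) = ρ`. -/
def partiallyIncoherentStates {a b : Type*} [Fintype a] [Fintype b] [DecidableEq b]
    (P : Fin 2 → Matrix a a ℂ) : Set (Matrix (a × b) (a × b) ℂ) :=
  {ρ | IsState ρ ∧ localMeasurement P ρ = ρ}

/-- The probability `tr (A ρ A†)` of the outcome with Kraus operator `A`. -/
def outcomeProb {n : Type*} [Fintype n] (A ρ : Matrix n n ℂ) : ℝ :=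
  (A * ρ * Aᴴ).trace.re

/-- The post-selected state `A ρ A† / tr (A ρ A†)` (meaningful for nonzero probability). -/
def outcomeState {n : Type*} [Fintype n] (A ρ : Matrix n n ℂ) : Matrix n n ℂ :=
  ((outcomeProb A ρ)⁻¹ : ℂ) • (A * ρ * Aᴴ)

/-- Kraus operators of a partially incoherent operation: the map `ρ ↦ ∑ₖ Aₖ ρ Aₖ†` is trace
preserving, and every `Aₖ` sends partially incoherent states to partially incoherent states
(after normalisation, whenever the outcome has nonzero probability). -/
structure IsPartiallyIncoherentKraus {a b ι : Type*} [Fintype a] [DecidableEq a] [Fintype b]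
    [DecidableEq b] [Fintype ι] (P : Fin 2 → Matrix a a ℂ)
    (A : ι → Matrix (a × b) (a × b) ℂ) : Prop where
  tracePreserving : ∑ k, (A k)ᴴ * A k = 1
  incoherent : ∀ k, ∀ σ ∈ partiallyIncoherentStates (b := b) P,
    outcomeProb (A k) σ ≠ 0 → outcomeState (A k) σ ∈ partiallyIncoherentStates (b := b) P

end WeakCoherence

end

/-! Since `tau1 ^ 2 + tau2 ^ 2 = 1`, the weak measurement fixes the diagonal blocks and scales the
off-diagonal ones by `2 τ₁ τ₂`. Hence `C_H(M|Ω) = (1 - 2 τ₁ τ₂)² (tr M - ‖Π^a(√M)‖²)` for `M ≥ 0`,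
which is homogeneous of degree one. As traces add up over outcomes, it remains to show `‖Π^a(√ρ)‖² ≤
∑ₖ ‖Π^a(√(Aₖ ρ Aₖ†))‖²`, which is `hsSq_localMeasurement_sqrt_le`.

Put `D = Π^a(√ρ)` and `σ = D²`, a block-diagonal positive operator with `tr(√ρ √σ) = ‖D‖²`. Data
processing for the affinity (`re_trace_mul_le_sum`) bounds this by `∑ₖ tr(√(Aₖ ρ Aₖ†) √(Aₖ σ Aₖ†))`.
Each `Aₖ σ Aₖ†` is block diagonal, hence so is its root; only the diagonal part of the other factor
counts, and `2 Re⟨M, N⟩ ≤ ‖M‖² + ‖N‖²` concludes.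

Data processing rests on the extremal property of the geometric mean (`re_dotProduct_mulVec_le`): a
Hermitian form dominated off the diagonal by `p²` and `q²` is at most `p q`. -/

noncomputable section

namespace WeakCoherence

/-! ### Hermitian forms below a geometric mean -/

/-- If a Hermitian form `X` satisfies `2 Re ⟨u, X v⟩ ≤ ⟨u, p² u⟩ + ⟨v, q² v⟩` for positive diagonal
`p, q`, then `X ≤ p q`. -/
theorem re_dotProduct_mulVec_le_of_pos {N : Type*} [Fintype N] [DecidableEq N]
    {X : Matrix N N ℂ} (hX : X.IsHermitian) {p q : N → ℝ} (hp : ∀ i, 0 < p i) (hq : ∀ i, 0 < q i)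
    (h : ∀ u v : N → ℂ, 2 * (star u ⬝ᵥ X *ᵥ v).re ≤
      ∑ i, p i ^ 2 * ‖u i‖ ^ 2 + ∑ i, q i ^ 2 * ‖v i‖ ^ 2) (w : N → ℂ) :
    (star w ⬝ᵥ X *ᵥ w).re ≤ ∑ i, p i * q i * ‖w i‖ ^ 2 := by
  -- Conjugating by `(p q)^(-1/2)` turns the claim into `Y ≤ 1`, checked on eigenvectors.
  set r : N → ℝ := fun i => Real.sqrt (p i * q i) with hr
  have hr0 : ∀ i, 0 < r i := fun i => Real.sqrt_pos.2 (mul_pos (hp i) (hq i))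
  have hrsq : ∀ i, r i ^ 2 = p i * q i := fun i => Real.sq_sqrt (mul_pos (hp i) (hq i)).le
  have hrC : ∀ i, (r i : ℂ) ≠ 0 := fun i => Complex.ofReal_ne_zero.2 (hr0 i).ne'
  set Y : Matrix N N ℂ := Matrix.of fun i j => (r i : ℂ)⁻¹ * X i j * (r j : ℂ)⁻¹ with hY
  have hYX : ∀ (z : N → ℂ) (i : N), (Y *ᵥ z) i
      = (r i : ℂ)⁻¹ * (X *ᵥ fun j => (r j : ℂ)⁻¹ * z j) i := by
    intro z i
    simp only [Matrix.mulVec, dotProduct, hY, Matrix.of_apply, Finset.mul_sum]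
    exact Finset.sum_congr rfl fun j _ => by ring
  have hYh : (1 - Y).IsHermitian := by
    refine Matrix.isHermitian_one.sub (Matrix.IsHermitian.ext fun i j => ?_)
    simp only [hY, Matrix.of_apply, star_mul', star_inv₀, RCLike.star_def, Complex.conj_ofReal]
    rw [← hX.apply i j, RCLike.star_def]
    ring
  have hpsd : (1 - Y).PosSemidef := by
    rw [hYh.posSemidef_iff_eigenvalues_nonneg]
    intro j
    set y : N → ℂ := (hYh.eigenvectorBasis j).ofLp with hy
    set μ : ℝ := hYh.eigenvalues j with hμ
    have hy0 : y ≠ 0 := by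
      intro h0
      have : hYh.eigenvectorBasis j = 0 := by
        ext i
        simpa using congrFun h0 i
      exact hYh.eigenvectorBasis.orthonormal.ne_zero j this
    have hev : ∀ i, (Y *ᵥ y) i = (1 - μ : ℝ) * y i := by
      intro i
      have := congrFun (hYh.mulVec_eigenvectorBasis j) i
      rw [Matrix.sub_mulVec, Matrix.one_mulVec] at this
      simp only [Pi.sub_apply, Pi.smul_apply, Complex.real_smul] at this
      push_cast
      linear_combination -this
    have hXv : ∀ i, (X *ᵥ fun j => (r j : ℂ)⁻¹ * y j) i = r i * ((1 - μ : ℝ) * y i) := by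
      intro i
      rw [← hev i, hYX, mul_inv_cancel_left₀ (hrC i)]
    -- The weight `q / p` on `u` makes both sums on the right of `h` equal to `∑ (q / p) |y|²`,
    -- while the left is `2 (1 - μ)` times that sum; hence `μ ≥ 0`.
    have key := h (fun i => ((q i / p i : ℝ) : ℂ) * ((r i : ℂ)⁻¹ * y i))
      (fun j => (r j : ℂ)⁻¹ * y j)
    have e1 : star (fun i => ((q i / p i : ℝ) : ℂ) * ((r i : ℂ)⁻¹ * y i)) ⬝ᵥ
        (X *ᵥ fun j => (r j : ℂ)⁻¹ * y j)
        = (((1 - μ) * ∑ i, q i / p i * ‖y i‖ ^ 2 : ℝ) : ℂ) := by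
      simp only [dotProduct, hXv]
      push_cast
      rw [Finset.mul_sum]
      refine Finset.sum_congr rfl fun i _ => ?_
      have := Complex.conj_mul' (y i)
      have h2 := hrC i
      simp only [Pi.star_apply, star_mul', star_inv₀, RCLike.star_def, Complex.conj_ofReal,
        map_div₀]
      rw [← this]
      field_simp
    have e2 : ∀ i, p i ^ 2 * ‖((q i / p i : ℝ) : ℂ) * ((r i : ℂ)⁻¹ * y i)‖ ^ 2
        = q i / p i * ‖y i‖ ^ 2 := by
      intro i
      have h1 := (hp i).ne'
      have h2 := (hq i).ne'
      rw [norm_mul, norm_mul, norm_inv, Complex.norm_real, Complex.norm_real, mul_pow, mul_pow,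
        inv_pow, Real.norm_eq_abs, Real.norm_eq_abs, sq_abs, sq_abs, hrsq]
      field_simp
    have e3 : ∀ i, q i ^ 2 * ‖(r i : ℂ)⁻¹ * y i‖ ^ 2 = q i / p i * ‖y i‖ ^ 2 := by
      intro i
      have h1 := (hp i).ne'
      have h2 := (hq i).ne'
      rw [norm_mul, norm_inv, Complex.norm_real, mul_pow, inv_pow, Real.norm_eq_abs, sq_abs, hrsq]
      field_simp
    rw [e1, Complex.ofReal_re] at key
    simp only [e2, e3] at key
    have hs : 0 < ∑ i, q i / p i * ‖y i‖ ^ 2 := by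
      obtain ⟨i, hi⟩ := Function.ne_iff.1 hy0
      refine Finset.sum_pos' (fun i _ => ?_) ⟨i, Finset.mem_univ i, ?_⟩
      · exact mul_nonneg (div_pos (hq i) (hp i)).le (sq_nonneg _)
      · exact mul_pos (div_pos (hq i) (hp i)) (pow_pos (norm_pos_iff.2 hi) 2)
    change 0 ≤ μ
    by_contra! hneg
    nlinarith
  have hfin := hpsd.re_dotProduct_nonneg fun i => (r i : ℂ) * w i
  have e4 : (fun j => (r j : ℂ)⁻¹ * ((r j : ℂ) * w j)) = w :=
    funext fun j => inv_mul_cancel_left₀ (hrC j) _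
  have e5 : star (fun i => (r i : ℂ) * w i) ⬝ᵥ ((1 - Y) *ᵥ fun i => (r i : ℂ) * w i)
      = ((∑ i, p i * q i * ‖w i‖ ^ 2 : ℝ) : ℂ) - star w ⬝ᵥ X *ᵥ w := by
    rw [Matrix.sub_mulVec, Matrix.one_mulVec, dotProduct_sub]
    congr 1
    · simp only [dotProduct]
      push_cast
      refine Finset.sum_congr rfl fun i _ => ?_
      rw [← Complex.conj_mul' (w i), ← Complex.ofReal_mul, ← hrsq i]
      simp only [Pi.star_apply, star_mul', RCLike.star_def, Complex.conj_ofReal]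
      push_cast
      ring
    · simp only [dotProduct, hYX, e4]
      refine Finset.sum_congr rfl fun i _ => ?_
      have h2 := hrC i
      simp only [Pi.star_apply, star_mul', RCLike.star_def, Complex.conj_ofReal]
      field_simp
  rw [e5, RCLike.re_to_complex, Complex.sub_re, Complex.ofReal_re] at hfin
  linarith

/-- Perturbing to `p + ε`, `q + ε` only weakens the hypothesis; then `ε → 0`. -/
theorem re_dotProduct_mulVec_le {N : Type*} [Fintype N] [DecidableEq N]
    {X : Matrix N N ℂ} (hX : X.IsHermitian) {p q : N → ℝ} (hp : ∀ i, 0 ≤ p i) (hq : ∀ i, 0 ≤ q i)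
    (h : ∀ u v : N → ℂ, 2 * (star u ⬝ᵥ X *ᵥ v).re ≤
      ∑ i, p i ^ 2 * ‖u i‖ ^ 2 + ∑ i, q i ^ 2 * ‖v i‖ ^ 2) (w : N → ℂ) :
    (star w ⬝ᵥ X *ᵥ w).re ≤ ∑ i, p i * q i * ‖w i‖ ^ 2 := by
  have hlim : Filter.Tendsto (fun ε : ℝ => ∑ i, (p i + ε) * (q i + ε) * ‖w i‖ ^ 2)
      (nhdsWithin 0 (Set.Ioi 0)) (nhds (∑ i, p i * q i * ‖w i‖ ^ 2)) := by
    have hc : Continuous fun ε : ℝ => ∑ i, (p i + ε) * (q i + ε) * ‖w i‖ ^ 2 := by fun_prop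
    simpa using (hc.tendsto 0).mono_left nhdsWithin_le_nhds
  refine ge_of_tendsto hlim (eventually_nhdsWithin_of_forall fun ε (hε : 0 < ε) => ?_)
  refine re_dotProduct_mulVec_le_of_pos hX (fun i => by linarith [hp i])
    (fun i => by linarith [hq i]) (fun u v => (h u v).trans ?_) w
  gcongr with i _ i _
  · exact hp i
  · linarith
  · exact hq i
  · linarith

/-! ### Hilbert-Schmidt estimates and data processing for the affinity -/

/-- The squared Hilbert-Schmidt norm `tr (M† M)`. -/
def hsSq {m n : Type*} [Fintype m] [Fintype n] (M : Matrix m n ℂ) : ℝ := (Mᴴ * M).trace.re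

section HilbertSchmidt

variable {n : Type*} [Fintype n]

theorem hsSq_eq_sum {m : Type*} [Fintype m] (M : Matrix m n ℂ) :
    hsSq M = ∑ i, ∑ j, ‖M i j‖ ^ 2 := by
  rw [hsSq, Matrix.trace, Complex.re_sum, Finset.sum_comm]
  refine Finset.sum_congr rfl fun j _ => ?_
  rw [Matrix.diag_apply, Matrix.mul_apply, Complex.re_sum]
  refine Finset.sum_congr rfl fun i _ => ?_
  rw [Matrix.conjTranspose_apply, RCLike.star_def, Complex.conj_mul', ← Complex.ofReal_pow,
    Complex.ofReal_re]

theorem hsSq_nonneg (M : Matrix n n ℂ) : 0 ≤ hsSq M := by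
  rw [hsSq_eq_sum]
  positivity

theorem hsSq_conjTranspose (M : Matrix n n ℂ) : hsSq Mᴴ = hsSq M := by
  rw [hsSq_eq_sum, hsSq_eq_sum, Finset.sum_comm]
  simp

theorem re_trace_conjTranspose_mul_comm (M N : Matrix n n ℂ) :
    (Nᴴ * M).trace.re = (Mᴴ * N).trace.re := by
  rw [← Matrix.conjTranspose_conjTranspose (Nᴴ * M), Matrix.trace_conjTranspose,
    Matrix.conjTranspose_mul, Matrix.conjTranspose_conjTranspose, RCLike.star_def, Complex.conj_re]

theorem hsSq_sub (M N : Matrix n n ℂ) :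
    hsSq (M - N) = hsSq M + hsSq N - 2 * (Mᴴ * N).trace.re := by
  have h := re_trace_conjTranspose_mul_comm M N
  simp only [hsSq, Matrix.conjTranspose_sub, Matrix.sub_mul, Matrix.mul_sub, Matrix.trace_sub,
    Complex.sub_re, h]
  ring

theorem two_mul_re_trace_le (M N : Matrix n n ℂ) :
    2 * (Mᴴ * N).trace.re ≤ hsSq M + hsSq N := by
  have := hsSq_nonneg (M - N)
  rw [hsSq_sub] at this
  linarith

/-- A commuting operator-mean inequality for linear maps into Hilbert-Schmidt space. -/
theorem re_trace_le_of_linearMap {N : Type*} [Fintype N] [DecidableEq N]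
    (F G : (N → ℂ) →ₗ[ℂ] Matrix n n ℂ)
    (hFG : ∀ u v, ((F u)ᴴ * G v).trace = ((G u)ᴴ * F v).trace)
    {p q : N → ℝ} (hp : ∀ i, 0 ≤ p i) (hq : ∀ i, 0 ≤ q i)
    (hF : ∀ u, hsSq (F u) ≤ ∑ i, p i ^ 2 * ‖u i‖ ^ 2)
    (hG : ∀ u, hsSq (G u) ≤ ∑ i, q i ^ 2 * ‖u i‖ ^ 2) (w : N → ℂ) :
    ((F w)ᴴ * G w).trace.re ≤ ∑ i, p i * q i * ‖w i‖ ^ 2 := by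
  let e : N → N → ℂ := fun i j => if i = j then 1 else 0
  let X : Matrix N N ℂ := Matrix.of fun i j => ((F (e i))ᴴ * G (e j)).trace
  have hX : ∀ u v, star u ⬝ᵥ X *ᵥ v = ((F u)ᴴ * G v).trace := by
    intro u v
    rw [F.pi_apply_eq_sum_univ u, G.pi_apply_eq_sum_univ v, Matrix.conjTranspose_sum,
      Finset.sum_mul, Matrix.trace_sum]
    simp only [dotProduct, Matrix.mulVec, Finset.mul_sum, Matrix.trace_sum]
    refine Finset.sum_congr rfl fun i _ => Finset.sum_congr rfl fun j _ => ?_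
    rw [Matrix.conjTranspose_smul, Matrix.smul_mul, Matrix.mul_smul, Matrix.trace_smul,
      Matrix.trace_smul, smul_eq_mul, smul_eq_mul, Pi.star_apply]
    simp only [X, e, Matrix.of_apply]
    ring
  have hXh : X.IsHermitian := by
    refine Matrix.IsHermitian.ext fun i j => ?_
    simp only [X, Matrix.of_apply]
    rw [hFG (e i), ← Matrix.trace_conjTranspose, Matrix.conjTranspose_mul,
      Matrix.conjTranspose_conjTranspose]
  rw [← hX]
  refine re_dotProduct_mulVec_le hXh hp hq (fun u v => ?_) w
  rw [hX]
  exact (two_mul_re_trace_le _ _).trans (add_le_add (hF u) (hG v))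

/-- Both sides depend only on the Gram operator `B R² B†`, so `R B†` may be traded for the root `R'`
of that operator. -/
theorem hsSq_mul_eq_of_sq_eq {R R' B : Matrix n n ℂ} (hR : R.IsHermitian) (hR' : R'.IsHermitian)
    (h : R' * R' = B * (R * R) * Bᴴ) (M : Matrix n n ℂ) :
    hsSq (R * Bᴴ * M) = hsSq (R' * M) := by
  simp only [hsSq, Matrix.conjTranspose_mul, Matrix.conjTranspose_conjTranspose, hR.eq, hR'.eq]
  rw [show Mᴴ * (B * R) * (R * Bᴴ * M) = Mᴴ * (B * (R * R) * Bᴴ) * M by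
    simp only [Matrix.mul_assoc], ← h]
  simp only [Matrix.mul_assoc]

variable [DecidableEq n]

/-- The column `(Aₖ)` is an isometry, so multiplying the row `(Bₖ)` by it is contractive. With `S`
the sum, both `∑ₖ ‖S Aₖ†‖²` and `∑ₖ Re⟨S Aₖ†, Bₖ⟩` equal `‖S‖²`. -/
theorem hsSq_sum_mul_le {ι : Type*} [Fintype ι] {A : ι → Matrix n n ℂ}
    (hA : ∑ k, (A k)ᴴ * A k = 1) (B : ι → Matrix n n ℂ) :
    hsSq (∑ k, B k * A k) ≤ ∑ k, hsSq (B k) := by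
  set S := ∑ k, B k * A k with hS
  have h1 : ∑ k, hsSq (S * (A k)ᴴ) = hsSq S := by
    simp only [hsSq, ← Complex.re_sum, ← Matrix.trace_sum]
    have : ∀ k, ((S * (A k)ᴴ)ᴴ * (S * (A k)ᴴ)).trace = (S * ((A k)ᴴ * A k) * Sᴴ).trace := by
      intro k
      rw [Matrix.trace_mul_comm, Matrix.conjTranspose_mul, Matrix.conjTranspose_conjTranspose]
      simp only [Matrix.mul_assoc]
    rw [Matrix.trace_sum]
    simp only [this]
    rw [← Matrix.trace_sum, ← Finset.sum_mul, ← Finset.mul_sum, hA, Matrix.mul_one,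
      Matrix.trace_mul_comm]
  have h2 : ∑ k, ((S * (A k)ᴴ)ᴴ * B k).trace.re = hsSq S := by
    have : ∀ k, ((S * (A k)ᴴ)ᴴ * B k).trace = (Sᴴ * (B k * A k)).trace := by
      intro k
      rw [Matrix.conjTranspose_mul, Matrix.conjTranspose_conjTranspose, Matrix.mul_assoc,
        Matrix.trace_mul_comm, Matrix.mul_assoc]
    simp only [this, hsSq]
    rw [← Complex.re_sum, ← Matrix.trace_sum, ← Finset.mul_sum, ← hS]
  have h3 : 2 * ∑ k, ((S * (A k)ᴴ)ᴴ * B k).trace.re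
      ≤ ∑ k, hsSq (S * (A k)ᴴ) + ∑ k, hsSq (B k) := by
    rw [Finset.mul_sum, ← Finset.sum_add_distrib]
    exact Finset.sum_le_sum fun k _ => two_mul_re_trace_le _ _
  rw [h1, h2] at h3
  linarith

theorem hsSq_unitary_mul {U : Matrix n n ℂ} (hU : Uᴴ * U = 1) (M : Matrix n n ℂ) :
    hsSq (U * M) = hsSq M := by
  rw [hsSq, Matrix.conjTranspose_mul, Matrix.mul_assoc, ← Matrix.mul_assoc Uᴴ, hU, Matrix.one_mul,
    hsSq]

theorem hsSq_mul_unitary {U : Matrix n n ℂ} (hU : Uᴴ * U = 1) (M : Matrix n n ℂ) :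
    hsSq (M * Uᴴ) = hsSq M := by
  rw [← hsSq_conjTranspose, Matrix.conjTranspose_mul, Matrix.conjTranspose_conjTranspose,
    hsSq_unitary_mul hU, hsSq_conjTranspose]

theorem exists_unitary_diagonal {M : Matrix n n ℂ} (hM : M.PosSemidef) :
    ∃ (U : Matrix n n ℂ) (d : n → ℝ), Uᴴ * U = 1 ∧ U * Uᴴ = 1 ∧ (∀ i, 0 ≤ d i) ∧
      M = U * Matrix.diagonal (fun i => (d i : ℂ)) * Uᴴ := by
  refine ⟨hM.1.eigenvectorUnitary, hM.1.eigenvalues, ?_, ?_, hM.eigenvalues_nonneg, ?_⟩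
  · exact Unitary.coe_star_mul_self hM.1.eigenvectorUnitary
  · exact Unitary.coe_mul_star_self hM.1.eigenvectorUnitary
  · conv_lhs => rw [hM.1.spectral_theorem]
    rfl

theorem hsSq_diagonal_mul (d : n → ℝ) (M : Matrix n n ℂ) :
    hsSq (Matrix.diagonal (fun i => (d i : ℂ)) * M) = ∑ i, ∑ j, d i ^ 2 * ‖M i j‖ ^ 2 := by
  simp [hsSq_eq_sum, Matrix.diagonal_mul, mul_pow]

theorem hsSq_mul_diagonal (d : n → ℝ) (M : Matrix n n ℂ) :
    hsSq (M * Matrix.diagonal (fun i => (d i : ℂ))) = ∑ i, ∑ j, d j ^ 2 * ‖M i j‖ ^ 2 := by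
  simp [hsSq_eq_sum, Matrix.mul_diagonal, mul_pow, mul_comm]

theorem hsSq_unitary_diagonal_mul {U W : Matrix n n ℂ} (hU : Uᴴ * U = 1) (hW : Wᴴ * W = 1)
    (r : n → ℝ) (M : Matrix n n ℂ) :
    hsSq (U * Matrix.diagonal (fun i => (r i : ℂ)) * Uᴴ * (U * M * Wᴴ))
      = ∑ i, ∑ j, r i ^ 2 * ‖M i j‖ ^ 2 := by
  rw [← Matrix.mul_assoc _ _ Wᴴ, hsSq_mul_unitary hW, Matrix.mul_assoc, ← Matrix.mul_assoc Uᴴ, hU,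
    Matrix.one_mul, Matrix.mul_assoc, hsSq_unitary_mul hU, hsSq_diagonal_mul]

theorem hsSq_mul_unitary_diagonal {U W : Matrix n n ℂ} (hU : Uᴴ * U = 1) (hW : Wᴴ * W = 1)
    (d : n → ℝ) (M : Matrix n n ℂ) :
    hsSq (U * M * Wᴴ * (W * Matrix.diagonal (fun i => (d i : ℂ)) * Wᴴ))
      = ∑ i, ∑ j, d j ^ 2 * ‖M i j‖ ^ 2 := by
  rw [← Matrix.mul_assoc _ _ Wᴴ, hsSq_mul_unitary hW, Matrix.mul_assoc, ← Matrix.mul_assoc Wᴴ, hW,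
    Matrix.one_mul, Matrix.mul_assoc, hsSq_unitary_mul hU, hsSq_mul_diagonal]

theorem re_trace_unitary_diagonal_mul (U W : Matrix n n ℂ) (r d : n → ℝ) :
    ((U * Matrix.diagonal (fun i => (r i : ℂ)) * Uᴴ) *
      (W * Matrix.diagonal (fun i => (d i : ℂ)) * Wᴴ)).trace.re
      = ∑ i, ∑ j, r i * d j * ‖(Uᴴ * W) i j‖ ^ 2 := by
  have : ((U * Matrix.diagonal (fun i => (r i : ℂ)) * Uᴴ) *
      (W * Matrix.diagonal (fun i => (d i : ℂ)) * Wᴴ)).trace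
      = ((Matrix.diagonal (fun i => (r i : ℂ)) * (Uᴴ * W) *
        Matrix.diagonal (fun i => (d i : ℂ))) * (Uᴴ * W)ᴴ).trace := by
    rw [Matrix.conjTranspose_mul, Matrix.conjTranspose_conjTranspose, ← Matrix.mul_assoc _ Wᴴ U,
      Matrix.trace_mul_comm _ U]
    simp only [Matrix.mul_assoc]
  rw [this, Matrix.trace, Complex.re_sum]
  refine Finset.sum_congr rfl fun i _ => ?_
  rw [Matrix.diag_apply, Matrix.mul_apply, Complex.re_sum]
  refine Finset.sum_congr rfl fun j _ => ?_
  rw [Matrix.mul_diagonal, Matrix.diagonal_mul, Matrix.conjTranspose_apply, RCLike.star_def]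
  have h := Complex.mul_conj' ((Uᴴ * W) i j)
  have : (r i : ℂ) * (Uᴴ * W) i j * (d j : ℂ) * (starRingEnd ℂ) ((Uᴴ * W) i j)
      = ((r i * d j * ‖(Uᴴ * W) i j‖ ^ 2 : ℝ) : ℂ) := by
    push_cast
    rw [← h]
    ring
  rw [this, Complex.ofReal_re]

/-- Data processing for the affinity `tr (√ρ √σ)`, with `R = √ρ`, `D = √σ` and `R' k`, `D' k` the
square roots of the unnormalised post-measurement operators. -/
theorem re_trace_mul_le_sum {ι : Type*} [Fintype ι] {A : ι → Matrix n n ℂ}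
    (hA : ∑ k, (A k)ᴴ * A k = 1) {R D : Matrix n n ℂ} (hR : R.IsHermitian) (hD : D.IsHermitian)
    {R' D' : ι → Matrix n n ℂ} (hR' : ∀ k, (R' k).PosSemidef) (hD' : ∀ k, (D' k).PosSemidef)
    (hRR : ∀ k, R' k * R' k = A k * (R * R) * (A k)ᴴ)
    (hDD : ∀ k, D' k * D' k = A k * (D * D) * (A k)ᴴ) :
    (R * D).trace.re ≤ ∑ k, (R' k * D' k).trace.re := by
  classical
  choose U r hU hU' hr hRU using fun k => exists_unitary_diagonal (hR' k)
  choose W d hW hW' hd hDW using fun k => exists_unitary_diagonal (hD' k)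
  -- Coordinates of `Z k` in the eigenbases of `R' k` and `D' k` make left and right multiplication
  -- by these operators diagonal at once.
  let Z : ι → (ι × n × n → ℂ) →ₗ[ℂ] Matrix n n ℂ := fun k =>
    { toFun := fun u => U k * Matrix.of (fun i j => u (k, i, j)) * (W k)ᴴ
      map_add' := fun u v => by
        rw [← Matrix.add_mul, ← Matrix.mul_add]
        rfl
      map_smul' := fun c u => by
        rw [RingHom.id_apply, ← Matrix.smul_mul, ← Matrix.mul_smul]
        rfl }
  -- `K` is the adjoint channel `(Zₖ) ↦ ∑ₖ Aₖ† Zₖ Aₖ`.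
  let K : (ι × n × n → ℂ) →ₗ[ℂ] Matrix n n ℂ :=
    ∑ k, (LinearMap.mulRight ℂ (A k)) ∘ₗ (LinearMap.mulLeft ℂ (A k)ᴴ) ∘ₗ Z k
  have hZ : ∀ k u, Z k u = U k * Matrix.of (fun i j => u (k, i, j)) * (W k)ᴴ := fun _ _ => rfl
  have hK : ∀ u, K u = ∑ k, (A k)ᴴ * Z k u * A k := fun u => by
    simp [K, LinearMap.sum_apply]
  clear_value K Z
  have hKR : ∀ u, hsSq (R * K u) ≤ ∑ x : ι × n × n, r x.1 x.2.1 ^ 2 * ‖u x‖ ^ 2 := by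
    intro u
    have e1 : R * K u = ∑ k, (R * (A k)ᴴ * Z k u) * A k := by
      rw [hK, Finset.mul_sum]
      simp only [Matrix.mul_assoc]
    have e2 : ∀ k, hsSq (R * (A k)ᴴ * Z k u)
        = ∑ i, ∑ j, r k i ^ 2 * ‖u (k, i, j)‖ ^ 2 := by
      intro k
      rw [hsSq_mul_eq_of_sq_eq hR (hR' k).1 (hRR k), hRU k, hZ,
        hsSq_unitary_diagonal_mul (hU k) (hW k)]
      simp only [Matrix.of_apply]
    rw [e1]
    refine (hsSq_sum_mul_le hA _).trans (le_of_eq ?_)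
    simp only [e2, Fintype.sum_prod_type]
  have hKD : ∀ u, hsSq (K u * D) ≤ ∑ x : ι × n × n, d x.1 x.2.2 ^ 2 * ‖u x‖ ^ 2 := by
    intro u
    -- Taking adjoints puts `Aₖ` on the right, as the contraction bound requires.
    have e1 : (K u * D)ᴴ = ∑ k, (D * (A k)ᴴ * (Z k u)ᴴ) * A k := by
      rw [hK, Finset.sum_mul, Matrix.conjTranspose_sum]
      refine Finset.sum_congr rfl fun k _ => ?_
      simp only [Matrix.conjTranspose_mul, Matrix.conjTranspose_conjTranspose, Matrix.mul_assoc,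
        hD.eq]
    have e2 : ∀ k, hsSq (D * (A k)ᴴ * (Z k u)ᴴ)
        = ∑ i, ∑ j, d k j ^ 2 * ‖u (k, i, j)‖ ^ 2 := by
      intro k
      rw [hsSq_mul_eq_of_sq_eq hD (hD' k).1 (hDD k), ← hsSq_conjTranspose,
        Matrix.conjTranspose_mul, Matrix.conjTranspose_conjTranspose, (hD' k).1.eq, hDW k, hZ,
        hsSq_mul_unitary_diagonal (hU k) (hW k)]
      simp only [Matrix.of_apply]
    rw [← hsSq_conjTranspose, e1]
    refine (hsSq_sum_mul_le hA _).trans (le_of_eq ?_)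
    simp only [e2, Fintype.sum_prod_type]
  -- These are the coordinates of `Zₖ = 1` for every `k`, so that `K w = ∑ₖ Aₖ† Aₖ = 1`.
  let w : ι × n × n → ℂ := fun x => ((U x.1)ᴴ * W x.1) x.2.1 x.2.2
  have hZw : ∀ k, Z k w = 1 := by
    intro k
    rw [hZ, show Matrix.of (fun i j => w (k, i, j)) = (U k)ᴴ * W k from rfl, ← Matrix.mul_assoc, hU', Matrix.one_mul, hW']
  have hKw : K w = 1 := by
    rw [hK]
    simp only [hZw, Matrix.mul_one, hA]
  have := re_trace_le_of_linearMap (LinearMap.mulLeft ℂ R ∘ₗ K) (LinearMap.mulRight ℂ D ∘ₗ K)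
    (fun u v => by
      simp only [LinearMap.comp_apply, LinearMap.mulLeft_apply, LinearMap.mulRight_apply,
        Matrix.conjTranspose_mul, hR.eq, hD.eq]
      rw [← Matrix.mul_assoc, Matrix.trace_mul_comm]
      simp only [Matrix.mul_assoc])
    (fun x => hr x.1 x.2.1) (fun x => hd x.1 x.2.2) hKR hKD w
  simp only [LinearMap.comp_apply, LinearMap.mulLeft_apply, LinearMap.mulRight_apply, hKw,
    Matrix.mul_one, Matrix.one_mul, hR.eq] at this
  refine this.trans (le_of_eq ?_)
  rw [Fintype.sum_prod_type]
  refine Finset.sum_congr rfl fun k _ => ?_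
  rw [hRU k, hDW k, re_trace_unitary_diagonal_mul, Fintype.sum_prod_type]

end HilbertSchmidt

/-! ### The local measurement as an orthogonal projection onto block-diagonal operators -/

section Measurement

variable {a b : Type*} [Fintype a] [Fintype b] [DecidableEq b] {P : Fin 2 → Matrix a a ℂ}

theorem localMeasurement_eq (P : Fin 2 → Matrix a a ℂ) (X : Matrix (a × b) (a × b) ℂ) :
    localMeasurement P X =
      (P 0 ⊗ₖ (1 : Matrix b b ℂ)) * X * (P 0 ⊗ₖ (1 : Matrix b b ℂ)) +
        (P 1 ⊗ₖ (1 : Matrix b b ℂ)) * X * (P 1 ⊗ₖ (1 : Matrix b b ℂ)) := by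
  rw [localMeasurement, Fin.sum_univ_two]

theorem tau1_sq_add_tau2_sq (x : ℝ) : tau1 x ^ 2 + tau2 x ^ 2 = 1 := by
  have h1 := Real.tanh_lt_one x
  have h2 := Real.neg_one_lt_tanh x
  rw [tau1, tau2, Real.sq_sqrt (by linarith), Real.sq_sqrt (by linarith)]
  ring

theorem conjTranspose_kronecker_one {a b : Type*} [DecidableEq b] {M : Matrix a a ℂ} (hM : M.IsHermitian) :
    (M ⊗ₖ (1 : Matrix b b ℂ))ᴴ = M ⊗ₖ (1 : Matrix b b ℂ) := by
  rw [Matrix.conjTranspose_kronecker, hM.eq, Matrix.conjTranspose_one]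

variable [DecidableEq a]

theorem IsTwoOutcomeProjective.kronecker_add {a b : Type*} [Fintype a] [DecidableEq a]
    [DecidableEq b] {P : Fin 2 → Matrix a a ℂ} (hP : IsTwoOutcomeProjective P) :
    P 0 ⊗ₖ (1 : Matrix b b ℂ) + P 1 ⊗ₖ (1 : Matrix b b ℂ) = 1 := by
  rw [← Matrix.add_kronecker, hP.sum_eq_one, Matrix.one_kronecker_one]

theorem IsTwoOutcomeProjective.kronecker_mul_self (hP : IsTwoOutcomeProjective P) (i : Fin 2) :
    (P i ⊗ₖ (1 : Matrix b b ℂ)) * (P i ⊗ₖ (1 : Matrix b b ℂ)) = P i ⊗ₖ (1 : Matrix b b ℂ) := by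
  rw [← Matrix.mul_kronecker_mul, hP.idempotent, Matrix.one_mul]

theorem IsTwoOutcomeProjective.kronecker_mul_of_ne (hP : IsTwoOutcomeProjective P) {i j : Fin 2}
    (hij : i ≠ j) : (P i ⊗ₖ (1 : Matrix b b ℂ)) * (P j ⊗ₖ (1 : Matrix b b ℂ)) = 0 := by
  rw [← Matrix.mul_kronecker_mul, hP.orthogonal i j hij, Matrix.zero_kronecker]

/-- In the four-block decomposition only the two off-diagonal blocks survive, each with coefficient
`1 - 2 τ₁ τ₂`. -/
theorem sub_weakMeasurement (hP : IsTwoOutcomeProjective P) (x : ℝ)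
    (X : Matrix (a × b) (a × b) ℂ) :
    X - weakMeasurement P x X
      = ((1 - 2 * (tau1 x * tau2 x) : ℝ) : ℂ) • (X - localMeasurement P X) := by
  have h1 : (tau1 x : ℂ) ^ 2 + (tau2 x : ℂ) ^ 2 = 1 := by exact_mod_cast tau1_sq_add_tau2_sq x
  have hs := hP.kronecker_add (b := b)
  rw [localMeasurement_eq, weakMeasurement, weakOpPos, weakOpNeg]
  simp only [Matrix.add_kronecker, Matrix.smul_kronecker]
  generalize P 0 ⊗ₖ (1 : Matrix b b ℂ) = Q at *
  generalize P 1 ⊗ₖ (1 : Matrix b b ℂ) = T at *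
  have hX : X = Q * X * Q + Q * X * T + T * X * Q + T * X * T := by
    calc X = (Q + T) * X * (Q + T) := by rw [hs, Matrix.one_mul, Matrix.mul_one]
      _ = _ := by noncomm_ring
  simp only [Matrix.add_mul, Matrix.mul_add, Matrix.smul_mul, Matrix.mul_smul]
  generalize hA : Q * X * Q = A at *
  generalize hB : Q * X * T = B at *
  generalize hC : T * X * Q = C at *
  generalize hD : T * X * T = D at *
  rw [hX]
  push_cast
  have h2 : (tau2 x : ℂ) ^ 2 = 1 - (tau1 x : ℂ) ^ 2 := by rw [← h1]; ring
  match_scalars <;> ring_nf <;> rw [h2] <;> ring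

theorem trace_conjTranspose_mul_localMeasurement (hP : IsTwoOutcomeProjective P)
    (M N : Matrix (a × b) (a × b) ℂ) :
    ((localMeasurement P M)ᴴ * localMeasurement P N).trace
      = (Mᴴ * localMeasurement P N).trace := by
  have h0 := conjTranspose_kronecker_one (b := b) (hP.isHermitian 0)
  have h1 := conjTranspose_kronecker_one (b := b) (hP.isHermitian 1)
  have i0 := hP.kronecker_mul_self (b := b) 0
  have i1 := hP.kronecker_mul_self (b := b) 1
  have o0 := hP.kronecker_mul_of_ne (b := b) zero_ne_one
  have o1 := hP.kronecker_mul_of_ne (b := b) one_ne_zero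
  rw [localMeasurement_eq, localMeasurement_eq]
  generalize P 0 ⊗ₖ (1 : Matrix b b ℂ) = Q at *
  generalize P 1 ⊗ₖ (1 : Matrix b b ℂ) = T at *
  have e : ∀ E Y : Matrix (a × b) (a × b) ℂ, E * E = E →
      (E * Mᴴ * E * (E * Y * E)).trace = (Mᴴ * (E * Y * E)).trace := by
    intro E Y hE
    rw [show E * Mᴴ * E * (E * Y * E) = E * (Mᴴ * ((E * E) * Y * E)) by
      simp only [Matrix.mul_assoc], hE, Matrix.trace_mul_comm,
      show Mᴴ * (E * Y * E) * E = Mᴴ * (E * Y * (E * E)) by simp only [Matrix.mul_assoc], hE]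
  have z : ∀ E E' Y : Matrix (a × b) (a × b) ℂ, E * E' = 0 →
      E * Mᴴ * E * (E' * Y * E') = 0 := by
    intro E E' Y h
    rw [show E * Mᴴ * E * (E' * Y * E') = E * Mᴴ * ((E * E') * Y * E') by
      simp only [Matrix.mul_assoc], h, Matrix.zero_mul, Matrix.zero_mul, Matrix.mul_zero]
  simp only [Matrix.conjTranspose_add, Matrix.conjTranspose_mul, h0, h1, Matrix.add_mul,
    Matrix.mul_add, Matrix.trace_add, ← Matrix.mul_assoc Q Mᴴ, ← Matrix.mul_assoc T Mᴴ]
  rw [e Q N i0, e T N i1, z Q T N o0, z T Q N o1, Matrix.trace_zero, zero_add, add_zero]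

theorem localMeasurement_posSemidef (hP : IsTwoOutcomeProjective P)
    {S : Matrix (a × b) (a × b) ℂ} (hS : S.PosSemidef) : (localMeasurement P S).PosSemidef := by
  have h0 := conjTranspose_kronecker_one (b := b) (hP.isHermitian 0)
  have h1 := conjTranspose_kronecker_one (b := b) (hP.isHermitian 1)
  rw [localMeasurement_eq]
  have p0 := hS.mul_mul_conjTranspose_same (P 0 ⊗ₖ (1 : Matrix b b ℂ))
  have p1 := hS.mul_mul_conjTranspose_same (P 1 ⊗ₖ (1 : Matrix b b ℂ))
  rw [h0] at p0
  rw [h1] at p1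
  exact p0.add p1

theorem localMeasurement_eq_self_iff (hP : IsTwoOutcomeProjective P)
    (X : Matrix (a × b) (a × b) ℂ) :
    localMeasurement P X = X ↔ ∀ i, Commute X (P i ⊗ₖ (1 : Matrix b b ℂ)) := by
  have i0 := hP.kronecker_mul_self (b := b) 0
  have i1 := hP.kronecker_mul_self (b := b) 1
  have o0 := hP.kronecker_mul_of_ne (b := b) zero_ne_one
  have o1 := hP.kronecker_mul_of_ne (b := b) one_ne_zero
  have hs := hP.kronecker_add (b := b)
  rw [localMeasurement_eq, Fin.forall_fin_two]
  generalize P 0 ⊗ₖ (1 : Matrix b b ℂ) = Q at *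
  generalize P 1 ⊗ₖ (1 : Matrix b b ℂ) = T at *
  constructor
  · intro h
    constructor
    · rw [Commute, SemiconjBy, ← h, Matrix.add_mul, Matrix.mul_add]
      simp only [Matrix.mul_assoc, i0, o1, Matrix.mul_zero]
      simp only [← Matrix.mul_assoc, i0, o0, Matrix.zero_mul]
    · rw [Commute, SemiconjBy, ← h, Matrix.add_mul, Matrix.mul_add]
      simp only [Matrix.mul_assoc, i1, o0, Matrix.mul_zero]
      simp only [← Matrix.mul_assoc, i1, o1, Matrix.zero_mul]
  · rintro ⟨h0, h1⟩
    rw [Matrix.mul_assoc, Matrix.mul_assoc, h0.eq, h1.eq, ← Matrix.mul_assoc, ← Matrix.mul_assoc,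
      i0, i1, ← Matrix.add_mul, hs, Matrix.one_mul]

theorem localMeasurement_localMeasurement (hP : IsTwoOutcomeProjective P)
    (X : Matrix (a × b) (a × b) ℂ) :
    localMeasurement P (localMeasurement P X) = localMeasurement P X := by
  have i0 := hP.kronecker_mul_self (b := b) 0
  have i1 := hP.kronecker_mul_self (b := b) 1
  have o0 := hP.kronecker_mul_of_ne (b := b) zero_ne_one
  have o1 := hP.kronecker_mul_of_ne (b := b) one_ne_zero
  rw [localMeasurement_eq_self_iff hP, Fin.forall_fin_two, localMeasurement_eq]
  generalize P 0 ⊗ₖ (1 : Matrix b b ℂ) = Q at *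
  generalize P 1 ⊗ₖ (1 : Matrix b b ℂ) = T at *
  constructor
  · rw [Commute, SemiconjBy, Matrix.add_mul, Matrix.mul_add]
    simp only [Matrix.mul_assoc, i0, o1, Matrix.mul_zero]
    simp only [← Matrix.mul_assoc, i0, o0, Matrix.zero_mul]
  · rw [Commute, SemiconjBy, Matrix.add_mul, Matrix.mul_add]
    simp only [Matrix.mul_assoc, i1, o0, Matrix.mul_zero]
    simp only [← Matrix.mul_assoc, i1, o1, Matrix.zero_mul]

theorem hsSq_sub_localMeasurement (hP : IsTwoOutcomeProjective P)
    (S : Matrix (a × b) (a × b) ℂ) :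
    hsSq (S - localMeasurement P S) = hsSq S - hsSq (localMeasurement P S) := by
  rw [hsSq_sub, ← trace_conjTranspose_mul_localMeasurement hP, ← hsSq]
  ring

end Measurement

/-! ### Square roots and outcome probabilities -/

section SquareRoot

variable {n : Type*} [Fintype n]

theorem hsSq_smul (c : ℝ) (M : Matrix n n ℂ) : hsSq ((c : ℂ) • M) = c ^ 2 * hsSq M := by
  simp [hsSq_eq_sum, mul_pow, Finset.mul_sum]

theorem eq_zero_of_re_trace_eq_zero {M : Matrix n n ℂ} (hM : M.PosSemidef)
    (h : M.trace.re = 0) : M = 0 := by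
  rw [← hM.trace_eq_zero_iff]
  exact Complex.ext h (Complex.nonneg_iff.1 hM.trace_nonneg).2.symm

variable [DecidableEq n]

theorem sqrt_posSemidef (M : Matrix n n ℂ) : (CFC.sqrt M).PosSemidef :=
  Matrix.nonneg_iff_posSemidef.1 (CFC.sqrt_nonneg M)

theorem sqrt_mul_sqrt {M : Matrix n n ℂ} (hM : M.PosSemidef) : CFC.sqrt M * CFC.sqrt M = M :=
  CFC.sqrt_mul_sqrt_self M (Matrix.nonneg_iff_posSemidef.2 hM)

theorem hsSq_sqrt {M : Matrix n n ℂ} (hM : M.PosSemidef) : hsSq (CFC.sqrt M) = M.trace.re := by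
  rw [hsSq, (sqrt_posSemidef M).1.eq, sqrt_mul_sqrt hM]

theorem commute_sqrt {M N : Matrix n n ℂ} (h : Commute M N) : Commute (CFC.sqrt M) N :=
  Commute.cfcₙ_nnreal h NNReal.sqrt

theorem sqrt_smul_of_nonneg {M : Matrix n n ℂ} (hM : M.PosSemidef) {c : ℝ} (hc : 0 ≤ c) :
    CFC.sqrt ((c : ℂ) • M) = ((Real.sqrt c : ℝ) : ℂ) • CFC.sqrt M := by
  refine CFC.sqrt_unique ?_ ?_
  · rw [smul_mul_smul_comm, sqrt_mul_sqrt hM, ← Complex.ofReal_mul, Real.mul_self_sqrt hc]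
  · exact Matrix.nonneg_iff_posSemidef.2
      ((sqrt_posSemidef M).smul (Complex.zero_le_real.2 (Real.sqrt_nonneg c)))

theorem sum_outcomeProb {ι : Type*} [Fintype ι] {A : ι → Matrix n n ℂ}
    (hA : ∑ k, (A k)ᴴ * A k = 1) (σ : Matrix n n ℂ) :
    ∑ k, outcomeProb (A k) σ = σ.trace.re := by
  have : ∀ k, (A k * σ * (A k)ᴴ).trace = ((A k)ᴴ * A k * σ).trace := fun k => by
    rw [Matrix.trace_mul_comm, Matrix.mul_assoc]
  simp only [outcomeProb, this]
  rw [← Complex.re_sum, ← Matrix.trace_sum, ← Finset.sum_mul, hA, Matrix.one_mul]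

end SquareRoot

/-! ### Strong monotonicity -/

section Monotonicity

variable {a b : Type*} [Fintype a] [DecidableEq a] [Fintype b] [DecidableEq b]
  {P : Fin 2 → Matrix a a ℂ}

theorem weakCoherence_eq (hP : IsTwoOutcomeProjective P) (x : ℝ)
    {M : Matrix (a × b) (a × b) ℂ} (hM : M.PosSemidef) :
    weakCoherence P x M = (1 - 2 * (tau1 x * tau2 x)) ^ 2 *
      (M.trace.re - hsSq (localMeasurement P (CFC.sqrt M))) := by
  rw [weakCoherence, hsNorm, ← hsSq, Real.sq_sqrt (hsSq_nonneg _), sub_weakMeasurement hP,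
    hsSq_smul, hsSq_sub_localMeasurement hP, hsSq_sqrt hM]

theorem localMeasurement_smul (c : ℂ) (M : Matrix (a × b) (a × b) ℂ) :
    localMeasurement P (c • M) = c • localMeasurement P M := by
  simp [localMeasurement]

/-- Homogeneity of degree one absorbs the normalisation. When the probability vanishes, positivity
forces `B ρ B† = 0`, so both sides are zero. -/
theorem outcomeProb_mul_weakCoherence (hP : IsTwoOutcomeProjective P) (x : ℝ)
    (B : Matrix (a × b) (a × b) ℂ) {ρ : Matrix (a × b) (a × b) ℂ} (hρ : ρ.PosSemidef) :
    outcomeProb B ρ * weakCoherence P x (outcomeState B ρ)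
      = weakCoherence P x (B * ρ * Bᴴ) := by
  have hM := hρ.mul_mul_conjTranspose_same B
  have hp : 0 ≤ outcomeProb B ρ := (Complex.nonneg_iff.1 hM.trace_nonneg).1
  rcases hp.eq_or_lt with h0 | h0
  · rw [eq_zero_of_re_trace_eq_zero hM h0.symm, ← h0, zero_mul,
      weakCoherence_eq hP x Matrix.PosSemidef.zero]
    simp [localMeasurement, hsSq]
  · have hinv := inv_nonneg.2 hp
    rw [outcomeState, ← Complex.ofReal_inv, weakCoherence_eq hP x hM,
      weakCoherence_eq hP x (hM.smul (Complex.zero_le_real.2 hinv)), sqrt_smul_of_nonneg hM hinv,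
      localMeasurement_smul, hsSq_smul, Real.sq_sqrt hinv, Matrix.trace_smul, smul_eq_mul,
      Complex.re_ofReal_mul]
    have := h0.ne'
    field_simp

/-- A partially incoherent Kraus operator preserves block-diagonality of positive operators. -/
theorem IsPartiallyIncoherentKraus.localMeasurement_conj {ι : Type*} [Fintype ι]
    {A : ι → Matrix (a × b) (a × b) ℂ} (hA : IsPartiallyIncoherentKraus P A)
    {σ : Matrix (a × b) (a × b) ℂ} (hσ : σ.PosSemidef) (hσP : localMeasurement P σ = σ) (k : ι) :
    localMeasurement P (A k * σ * (A k)ᴴ) = A k * σ * (A k)ᴴ := by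
  have hM := hσ.mul_mul_conjTranspose_same (A k)
  by_cases h0 : A k * σ * (A k)ᴴ = 0
  · simp [h0, localMeasurement]
  have ht : 0 ≤ σ.trace.re := (Complex.nonneg_iff.1 hσ.trace_nonneg).1
  have ht0 : σ.trace.re ≠ 0 := fun h => h0 (by
    rw [eq_zero_of_re_trace_eq_zero hσ h, Matrix.mul_zero, Matrix.zero_mul])
  have htr : σ.trace = (σ.trace.re : ℂ) :=
    Complex.ext rfl (Complex.nonneg_iff.1 hσ.trace_nonneg).2.symm
  have hc : ((σ.trace.re)⁻¹ : ℂ) ≠ 0 := inv_ne_zero (Complex.ofReal_ne_zero.2 ht0)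
  -- The hypothesis concerns states only, so `σ` is normalised first and the nonzero scalars are
  -- cancelled at the end.
  have hconj : A k * (((σ.trace.re)⁻¹ : ℂ) • σ) * (A k)ᴴ
      = ((σ.trace.re)⁻¹ : ℂ) • (A k * σ * (A k)ᴴ) := by
    rw [Matrix.mul_smul, Matrix.smul_mul]
  have hmem : ((σ.trace.re)⁻¹ : ℂ) • σ ∈ partiallyIncoherentStates (b := b) P := by
    refine ⟨⟨hσ.smul ?_, ?_⟩, ?_⟩
    · rw [← Complex.ofReal_inv]
      exact Complex.zero_le_real.2 (inv_nonneg.2 ht)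
    · rw [Matrix.trace_smul, smul_eq_mul, htr, Complex.ofReal_re]
      exact inv_mul_cancel₀ (Complex.ofReal_ne_zero.2 ht0)
    · rw [localMeasurement_smul, hσP]
  have hp : outcomeProb (A k) (((σ.trace.re)⁻¹ : ℂ) • σ) ≠ 0 := by
    rw [outcomeProb, hconj, Matrix.trace_smul, smul_eq_mul, ← Complex.ofReal_inv,
      Complex.re_ofReal_mul]
    exact mul_ne_zero (inv_ne_zero ht0) fun h => h0 (eq_zero_of_re_trace_eq_zero hM h)
  have h := (hA.incoherent k _ hmem hp).2
  rw [outcomeState, hconj, smul_smul, localMeasurement_smul] at h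
  exact smul_right_injective _ (mul_ne_zero (inv_ne_zero (Complex.ofReal_ne_zero.2 hp)) hc) h

/-- The squared norm of the block-diagonal part of `√ρ` does not decrease under a partially
incoherent operation. -/
theorem hsSq_localMeasurement_sqrt_le (hP : IsTwoOutcomeProjective P) {ι : Type*} [Fintype ι]
    {A : ι → Matrix (a × b) (a × b) ℂ} (hA : IsPartiallyIncoherentKraus P A)
    {ρ : Matrix (a × b) (a × b) ℂ} (hρ : ρ.PosSemidef) :
    hsSq (localMeasurement P (CFC.sqrt ρ)) ≤
      ∑ k, hsSq (localMeasurement P (CFC.sqrt (A k * ρ * (A k)ᴴ))) := by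
  set R := CFC.sqrt ρ with hR
  set D := localMeasurement P R with hD
  have hRp : R.PosSemidef := sqrt_posSemidef ρ
  have hDp : D.PosSemidef := localMeasurement_posSemidef hP hRp
  have hDD : (D * D).PosSemidef := by
    have := Matrix.posSemidef_conjTranspose_mul_self D
    rwa [hDp.1.eq] at this
  have hDfix : localMeasurement P (D * D) = D * D := by
    rw [localMeasurement_eq_self_iff hP]
    intro i
    have := (localMeasurement_eq_self_iff hP D).1 (localMeasurement_localMeasurement hP R) i
    exact this.mul_left this
  have hσ := fun k => hDD.mul_mul_conjTranspose_same (A k)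
  have hfix : ∀ k, localMeasurement P (CFC.sqrt (A k * (D * D) * (A k)ᴴ))
      = CFC.sqrt (A k * (D * D) * (A k)ᴴ) := by
    intro k
    rw [localMeasurement_eq_self_iff hP]
    intro i
    exact commute_sqrt
      ((localMeasurement_eq_self_iff hP _).1 (hA.localMeasurement_conj hDD hDfix k) i)
  -- The comparison operator `D²` need not have trace one; only its positivity and block-diagonality
  -- are used.
  have key := re_trace_mul_le_sum hA.tracePreserving hRp.1 hDp.1
    (fun k => sqrt_posSemidef (A k * ρ * (A k)ᴴ))
    (fun k => sqrt_posSemidef (A k * (D * D) * (A k)ᴴ))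
    (fun k => by rw [sqrt_mul_sqrt (hρ.mul_mul_conjTranspose_same _), hR, sqrt_mul_sqrt hρ])
    (fun k => sqrt_mul_sqrt (hσ k))
  have h1 : (R * D).trace.re = hsSq D := by
    rw [hsSq, hD, trace_conjTranspose_mul_localMeasurement hP, hRp.1.eq]
  have h2 : ∀ k, 2 * (CFC.sqrt (A k * ρ * (A k)ᴴ) *
        CFC.sqrt (A k * (D * D) * (A k)ᴴ)).trace.re
      ≤ hsSq (localMeasurement P (CFC.sqrt (A k * ρ * (A k)ᴴ)))
        + outcomeProb (A k) (D * D) := by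
    intro k
    rw [outcomeProb, ← hsSq_sqrt (hσ k)]
    refine le_trans (le_of_eq ?_) (two_mul_re_trace_le _ _)
    -- The second root is fixed by `Π^a`, so self-adjointness of the projection removes `Π^a` from
    -- the first.
    conv_rhs => rw [← hfix k, trace_conjTranspose_mul_localMeasurement hP, hfix k,
      (sqrt_posSemidef _).1.eq]
  have h3 : ∑ k, outcomeProb (A k) (D * D) = hsSq D := by
    rw [sum_outcomeProb hA.tracePreserving, hsSq, hDp.1.eq]
  have h4 := Finset.sum_le_sum fun k (_ : k ∈ Finset.univ) => h2 k
  rw [← Finset.mul_sum, Finset.sum_add_distrib, h3] at h4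
  linarith

end Monotonicity

end WeakCoherence

end

theorem mainTheorem4 {a b ι : Type*} [Fintype a] [DecidableEq a] [Fintype b] [DecidableEq b]
    [Fintype ι]
    (P : Fin 2 → Matrix a a ℂ) (hP : WeakCoherence.IsTwoOutcomeProjective P) (x : ℝ)
    (ρ : Matrix (a × b) (a × b) ℂ) (hρ : WeakCoherence.IsState ρ)
    (A : ι → Matrix (a × b) (a × b) ℂ)
    (hA : WeakCoherence.IsPartiallyIncoherentKraus P A) :
    ∑ k, WeakCoherence.outcomeProb (A k) ρ *
        WeakCoherence.weakCoherence P x (WeakCoherence.outcomeState (A k) ρ) ≤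
      WeakCoherence.weakCoherence P x ρ := by
  have h : ∀ k, WeakCoherence.outcomeProb (A k) ρ *
      WeakCoherence.weakCoherence P x (WeakCoherence.outcomeState (A k) ρ)
      = (1 - 2 * (WeakCoherence.tau1 x * WeakCoherence.tau2 x)) ^ 2 *
        (WeakCoherence.outcomeProb (A k) ρ - WeakCoherence.hsSq
          (WeakCoherence.localMeasurement P (CFC.sqrt (A k * ρ * (A k)ᴴ)))) := fun k => by
    rw [WeakCoherence.outcomeProb_mul_weakCoherence hP x (A k) hρ.1,
      WeakCoherence.weakCoherence_eq hP x (hρ.1.mul_mul_conjTranspose_same _),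
      WeakCoherence.outcomeProb]
  simp only [h]
  rw [← Finset.mul_sum, Finset.sum_sub_distrib, WeakCoherence.sum_outcomeProb hA.tracePreserving,
    WeakCoherence.weakCoherence_eq hP x hρ.1]
  exact mul_le_mul_of_nonneg_left
    (sub_le_sub_left (WeakCoherence.hsSq_localMeasurement_sqrt_le hP hA hρ.1) _) (sq_nonneg _)
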